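/- There is a universal constant $c_1>0$ such that the following holds. Let $p\ge 2$ and let $X_1,\dots,X_n$ be independent (not necessarily identically distributed) random row vectors in $\mathbb{R}^p$ with entries $X_{i,j}$, such that $\max_{i,j}|X_{i,j}|\le K_X$ almost surely for a constant $K_X$. For $\beta\in\mathbb{R}^p$ let $f_\beta(x):=x\beta$, $x \in \mathbb{R}^p$ (row vector), and put $$\|f_\beta\|_n^2:=\frac1n\sum_{i=1}^n f_\beta(X_i)^2,\qquad \|f_\beta\|^2:=\frac1n\sum_{i=1}^n \mathbb{E} f_\beta(X_i)^2,\qquad \Lambda_{\min}:=\Bigl(\min_{\|\beta\|_2=1}\|f_\beta\|^2\Bigr)^{1/2}.$$ Suppose $\Lambda_{\min}>0$. Then for all $t>0$ $$\mathbb{P}\left(\sup_{\beta:\,\|f_\beta\|\le 1}\Bigl|\|f_\beta\|_n^2-\|f_\beta\|^2\Bigr|\ \ge\ c_1\left[\frac{K_X}{\Lambda_{\min}}\sqrt{\frac{p\log p+pt}{n}}+\frac{K_X^2}{\Lambda_{\min}^2}\,\frac{p\log p+pt}{n}\right]\right)\le e^{-t}.$$ -/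

import Mathlib

open MeasureTheory ProbabilityTheory
open scoped ENNReal

noncomputable section

namespace EmpiricalNorm

variable {Ω 𝒳 : Type*} {n p : ℕ}

/-- The empirical measure `P_n f = (1/n) ∑ i, f (X_i)`, evaluated at the outcome `ω`. -/
def empMeasure (X : Fin n → Ω → 𝒳) (f : 𝒳 → ℝ) (ω : Ω) : ℝ :=
  (∑ i, f (X i ω)) / n

/-- The theoretical measure `P f = (1/n) ∑ i, 𝔼 f (X_i)`. -/
def theoMeasure [MeasurableSpace Ω] (μ : Measure Ω) (X : Fin n → Ω → 𝒳) (f : 𝒳 → ℝ) : ℝ :=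
  (∑ i, ∫ ω, f (X i ω) ∂μ) / n

/-- The empirical norm `‖f‖_n = (P_n f²)^{1/2}`. -/
def empNorm (X : Fin n → Ω → 𝒳) (f : 𝒳 → ℝ) (ω : Ω) : ℝ :=
  Real.sqrt (empMeasure X (fun x => f x ^ 2) ω)

/-- The theoretical norm `‖f‖ = (P f²)^{1/2}`. -/
def theoNorm [MeasurableSpace Ω] (μ : Measure Ω) (X : Fin n → Ω → 𝒳) (f : 𝒳 → ℝ) : ℝ :=
  Real.sqrt (theoMeasure μ X (fun x => f x ^ 2))

/-- The linear function `f_β (x) = x β`. -/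
def linFun (β : EuclideanSpace ℝ (Fin p)) (x : Fin p → ℝ) : ℝ :=
  ∑ j, x j * β j

/-- `Λ_min`, where `Λ_min² = min {‖f_β‖² : ‖β‖₂ = 1}` is the smallest eigenvalue of the
Gram matrix `(1/n) ∑ i, 𝔼 X_iᵀ X_i`. -/
def lambdaMin [MeasurableSpace Ω] (μ : Measure Ω) (X : Fin n → Ω → Fin p → ℝ) : ℝ :=
  Real.sqrt (sInf ((fun β : EuclideanSpace ℝ (Fin p) => theoNorm μ X (linFun β) ^ 2) ''
    {β | ‖β‖ = 1}))

/-- `sup {|‖f_β‖_n² - ‖f_β‖²| : ‖f_β‖ ≤ 1}`, at the outcome `ω`, as an element of `[0, ∞]`. -/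
def supDeviation [MeasurableSpace Ω] (μ : Measure Ω) (X : Fin n → Ω → Fin p → ℝ) (ω : Ω) :
    ℝ≥0∞ :=
  ⨆ (β : EuclideanSpace ℝ (Fin p)) (_ : theoNorm μ X (linFun β) ≤ 1),
    ENNReal.ofReal |empNorm X (linFun β) ω ^ 2 - theoNorm μ X (linFun β) ^ 2|

end EmpiricalNorm

end

/-! The supremum is an operator norm in disguise. With `W` whitening the Gram matrix and `Y i = Wᵀ X
i`, the condition `‖f_β‖ ≤ 1` becomes `z ⬝ᵥ z ≤ 1` for `β = W z`, so the supremum is at most `D /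
n`, where `D = ‖∑ i, (Y i)(Y i)ᵀ - n • 1‖`. The entry bound and `Λ_min` give `Y i ⬝ᵥ Y i ≤ B = p K²
/ Λ²`. It remains to find exponential moments of `D`.

Noncommutative Khintchine: for symmetric `A i` and random signs, the trace moments of `S = ∑ i, ε i
• A i` obey the Gaussian recursion `E tr S^(2m+2) ≤ (2m+1) ‖∑ i, A i²‖ E tr S^(2m)`, proved by
flipping one sign at a time and a mean value inequality under the trace. Summing the cosh series
gives `E exp(s‖S‖) ≤ 2d exp(s²‖∑ i, A i²‖/2)` (`sum_exp_norm_rademacherSum_le`).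

Symmetrization bounds `E exp(s D)` by `E exp(2s‖S‖)` with `A i = (Y i)(Y i)ᵀ`. Here `‖∑ i, A i²‖ ≤ B
‖∑ i, A i‖ ≤ B (D + n)`: the variance is controlled by the deviation itself. For `4sB ≤ 1` this
yields `E exp(sD) ≤ c E exp(sD/2) ≤ c (E exp(sD))^(1/2)`, hence `E exp(sD) ≤ c²`
(`integral_exp_norm_sum_rankOne_sub_le`). A Chernoff bound finishes; the dimension enters only
through `c`, which produces the term `log p`. -/

open scoped Matrix Matrix.Norms.L2Operator Nat

/-! ### Trace and operator norm inequalities for symmetric matrices. -/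

section MatrixInequalities

variable {d : Type*} [Fintype d] [DecidableEq d]

/-- A real symmetric matrix is orthogonally diagonalizable, together with all its powers. -/
lemma Matrix.IsHermitian.exists_orthogonal_diagonalization {H : Matrix d d ℝ}
    (hH : H.IsHermitian) :
    ∃ (U : Matrix.unitaryGroup d ℝ) (l : d → ℝ),
      ∀ k : ℕ, H ^ k = (U : Matrix d d ℝ) * Matrix.diagonal (l ^ k) * (U : Matrix d d ℝ)ᵀ := by
  refine ⟨hH.eigenvectorUnitary, hH.eigenvalues, fun k => ?_⟩
  have h1 := hH.spectral_theorem
  conv_lhs => rw [h1]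
  rw [← map_pow, Matrix.diagonal_pow, Unitary.conjStarAlgAut_apply]
  rfl

lemma Matrix.unitaryGroup.transpose_mul_self (U : Matrix.unitaryGroup d ℝ) :
    (U : Matrix d d ℝ)ᵀ * (U : Matrix d d ℝ) = 1 :=
  Matrix.UnitaryGroup.star_mul_self U

lemma Matrix.unitaryGroup.mul_transpose_self (U : Matrix.unitaryGroup d ℝ) :
    (U : Matrix d d ℝ) * (U : Matrix d d ℝ)ᵀ = 1 :=
  Unitary.coe_mul_star_self U

/-- The Frobenius inner product is invariant under orthogonal changes of basis. -/
lemma Matrix.trace_transpose_mul_eq_sum_orthogonal (U W : Matrix.unitaryGroup d ℝ)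
    (X Y : Matrix d d ℝ) :
    (Xᵀ * Y).trace = ∑ k, ∑ j, ((U : Matrix d d ℝ)ᵀ * X * (W : Matrix d d ℝ)) j k *
      ((U : Matrix d d ℝ)ᵀ * Y * (W : Matrix d d ℝ)) j k := by
  have h : (Xᵀ * Y).trace = (((U : Matrix d d ℝ)ᵀ * X * (W : Matrix d d ℝ))ᵀ *
      ((U : Matrix d d ℝ)ᵀ * Y * (W : Matrix d d ℝ))).trace := by
    rw [Matrix.transpose_mul, Matrix.transpose_mul, Matrix.transpose_transpose]
    have : (W : Matrix d d ℝ)ᵀ * (Xᵀ * (U : Matrix d d ℝ)) *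
        ((U : Matrix d d ℝ)ᵀ * Y * (W : Matrix d d ℝ)) =
        (W : Matrix d d ℝ)ᵀ * (Xᵀ * ((U : Matrix d d ℝ) * (U : Matrix d d ℝ)ᵀ) * Y *
          (W : Matrix d d ℝ)) := by
      simp only [Matrix.mul_assoc]
    rw [this, Matrix.unitaryGroup.mul_transpose_self, Matrix.mul_one,
      Matrix.trace_mul_comm (W : Matrix d d ℝ)ᵀ, Matrix.mul_assoc,
      Matrix.unitaryGroup.mul_transpose_self, Matrix.mul_one]
  rw [h]
  generalize (U : Matrix d d ℝ)ᵀ * X * (W : Matrix d d ℝ) = P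
  generalize (U : Matrix d d ℝ)ᵀ * Y * (W : Matrix d d ℝ) = R
  simp [Matrix.trace, Matrix.mul_apply]

/-- Rearrangement: `|a| ^ q - |b| ^ q` and `|a| ^ s - |b| ^ s` have the same sign. -/
lemma pow_mul_pow_add_pow_mul_pow_le (a b : ℝ) {q s m : ℕ} (h : q + s = 2 * m) :
    a ^ q * b ^ s + a ^ s * b ^ q ≤ a ^ (2 * m) + b ^ (2 * m) := by
  have e (x : ℝ) : x ^ (2 * m) = |x| ^ q * |x| ^ s := by
    rw [← pow_add, h, pow_mul, pow_mul, sq_abs]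
  have e2 (q s : ℕ) : a ^ q * b ^ s ≤ |a| ^ q * |b| ^ s := by
    rw [← abs_pow, ← abs_pow, ← abs_mul]; exact le_abs_self _
  have key : 0 ≤ (|a| ^ q - |b| ^ q) * (|a| ^ s - |b| ^ s) := by
    rcases le_total |a| |b| with hab | hab
    · exact mul_nonneg_of_nonpos_of_nonpos
        (sub_nonpos.2 (pow_le_pow_left₀ (abs_nonneg _) hab _))
        (sub_nonpos.2 (pow_le_pow_left₀ (abs_nonneg _) hab _))
    · exact mul_nonneg (sub_nonneg.2 (pow_le_pow_left₀ (abs_nonneg _) hab _))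
        (sub_nonneg.2 (pow_le_pow_left₀ (abs_nonneg _) hab _))
  rw [e a, e b]
  nlinarith [e2 q s, e2 s q]

/-- Factor the difference of powers as a geometric sum and pair each term with its mirror image.
This is the scalar case of the trace inequality below. -/
lemma two_mul_sub_mul_pow_sub_pow_le (a b : ℝ) (m : ℕ) :
    2 * ((a - b) * (a ^ (2 * m + 1) - b ^ (2 * m + 1))) ≤
      (2 * m + 1) * ((a - b) ^ 2 * (a ^ (2 * m) + b ^ (2 * m))) := by
  have h1 : 2 * ∑ i ∈ Finset.range (2 * m + 1), a ^ i * b ^ (2 * m + 1 - 1 - i) ≤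
      (2 * m + 1) * (a ^ (2 * m) + b ^ (2 * m)) := by
    have h2 := Finset.sum_range_reflect (fun i => a ^ i * b ^ (2 * m + 1 - 1 - i)) (2 * m + 1)
    rw [two_mul]
    nth_rw 2 [← h2]
    rw [← Finset.sum_add_distrib]
    calc _ ≤ ∑ i ∈ Finset.range (2 * m + 1), (a ^ (2 * m) + b ^ (2 * m)) := by
          refine Finset.sum_le_sum fun i hi => ?_
          have hi' : i ≤ 2 * m := by simpa [Nat.lt_succ_iff] using hi
          have e : 2 * m + 1 - 1 - (2 * m + 1 - 1 - i) = i := by omega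
          rw [e]
          exact pow_mul_pow_add_pow_mul_pow_le a b (by omega)
      _ = _ := by simp; ring
  rw [← geom_sum₂_mul]
  nlinarith [mul_le_mul_of_nonneg_left h1 (sq_nonneg (a - b))]

/-- A noncommutative mean value inequality for odd powers under the trace. -/
lemma Matrix.IsHermitian.trace_sub_mul_pow_sub_pow_le {H K : Matrix d d ℝ}
    (hH : H.IsHermitian) (hK : K.IsHermitian) (m : ℕ) :
    2 * ((H - K) * (H ^ (2 * m + 1) - K ^ (2 * m + 1))).trace ≤
      (2 * m + 1) * (((H - K) * (H - K) * H ^ (2 * m)).trace +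
        ((H - K) * (H - K) * K ^ (2 * m)).trace) := by
  obtain ⟨U, l, hU⟩ := hH.exists_orthogonal_diagonalization
  obtain ⟨W, k, hW⟩ := hK.exists_orthogonal_diagonalization
  have hT : (H - K)ᵀ = H - K := (hH.sub hK : (H - K).IsHermitian)
  set Q := (U : Matrix d d ℝ)ᵀ * (W : Matrix d d ℝ) with hQ
  have eH (a : ℕ) (X : Matrix d d ℝ) (i j : d) :
      ((U : Matrix d d ℝ)ᵀ * (H ^ a * X) * (W : Matrix d d ℝ)) i j =
        l i ^ a * ((U : Matrix d d ℝ)ᵀ * X * (W : Matrix d d ℝ)) i j := by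
    rw [hU a]
    have : (U : Matrix d d ℝ)ᵀ * ((U : Matrix d d ℝ) * Matrix.diagonal (l ^ a) *
        (U : Matrix d d ℝ)ᵀ * X) * (W : Matrix d d ℝ) = ((U : Matrix d d ℝ)ᵀ * (U : Matrix d d ℝ))
        * (Matrix.diagonal (l ^ a) * ((U : Matrix d d ℝ)ᵀ * X * (W : Matrix d d ℝ))) := by
      simp only [Matrix.mul_assoc]
    rw [this, Matrix.unitaryGroup.transpose_mul_self, Matrix.one_mul, Matrix.diagonal_mul]
    rfl
  have eK (a : ℕ) (X : Matrix d d ℝ) (i j : d) :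
      ((U : Matrix d d ℝ)ᵀ * (X * K ^ a) * (W : Matrix d d ℝ)) i j =
        ((U : Matrix d d ℝ)ᵀ * X * (W : Matrix d d ℝ)) i j * k j ^ a := by
    rw [hW a]
    have : (U : Matrix d d ℝ)ᵀ * (X * ((W : Matrix d d ℝ) * Matrix.diagonal (k ^ a) *
        (W : Matrix d d ℝ)ᵀ)) * (W : Matrix d d ℝ) =
        ((U : Matrix d d ℝ)ᵀ * X * (W : Matrix d d ℝ)) * Matrix.diagonal (k ^ a)
        * ((W : Matrix d d ℝ)ᵀ * (W : Matrix d d ℝ)) := by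
      simp only [Matrix.mul_assoc]
    rw [this, Matrix.unitaryGroup.transpose_mul_self, Matrix.mul_one, Matrix.mul_diagonal]
    rfl
  -- Seen through the eigenbasis of `H` on the left and that of `K` on the right, both matrices act
  -- as scalars on each entry. The trace inequality thus becomes the scalar one, weighted by `Q i j
  -- ^ 2`.
  have eD (a : ℕ) (i j : d) :
      ((U : Matrix d d ℝ)ᵀ * (H ^ a - K ^ a) * (W : Matrix d d ℝ)) i j =
        (l i ^ a - k j ^ a) * Q i j := by
    have h1 := eH a 1 i j
    have h2 := eK a 1 i j
    rw [Matrix.mul_one, Matrix.mul_one] at h1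
    rw [Matrix.one_mul, Matrix.mul_one] at h2
    rw [Matrix.mul_sub, Matrix.sub_mul, Matrix.sub_apply, h1, h2]
    ring
  have eD1 (i j : d) := eD 1 i j
  simp only [pow_one] at eD1
  have t (Y : Matrix d d ℝ) : ((H - K) * Y).trace =
      ∑ k, ∑ j, ((U : Matrix d d ℝ)ᵀ * (H - K) * (W : Matrix d d ℝ)) j k *
      ((U : Matrix d d ℝ)ᵀ * Y * (W : Matrix d d ℝ)) j k := by
    rw [← Matrix.trace_transpose_mul_eq_sum_orthogonal U W, hT]
  have t2 : ((H - K) * (H - K) * H ^ (2 * m)).trace =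
      ((H - K) * (H ^ (2 * m) * (H - K))).trace := by
    rw [← Matrix.mul_assoc, Matrix.trace_mul_comm _ (H - K), Matrix.mul_assoc]
  rw [t2, Matrix.mul_assoc _ _ (K ^ (2 * m)), t, t, t]
  simp only [eD, eD1, eH, eK, Finset.mul_sum, ← Finset.sum_add_distrib]
  refine Finset.sum_le_sum fun j _ => Finset.sum_le_sum fun i _ => ?_
  nlinarith [mul_le_mul_of_nonneg_left (two_mul_sub_mul_pow_sub_pow_le (l i) (k j) m)
    (sq_nonneg (Q i j))]

lemma Matrix.abs_dotProduct_mulVec_le (A : Matrix d d ℝ) (x : d → ℝ) :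
    |x ⬝ᵥ A *ᵥ x| ≤ ‖A‖ * (x ⬝ᵥ x) := by
  have h := Matrix.l2_opNorm_mulVec A (WithLp.toLp 2 x)
  have h2 := abs_real_inner_le_norm (WithLp.toLp 2 x) (WithLp.toLp 2 (A *ᵥ x))
  have h3 : inner ℝ (WithLp.toLp 2 x) (WithLp.toLp 2 (A *ᵥ x)) = x ⬝ᵥ A *ᵥ x := by
    rw [EuclideanSpace.inner_toLp_toLp, dotProduct_comm]; rfl
  have h4 : ‖WithLp.toLp 2 x‖ * ‖WithLp.toLp 2 x‖ = x ⬝ᵥ x := by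
    rw [← real_inner_self_eq_norm_mul_norm, EuclideanSpace.inner_toLp_toLp]; rfl
  rw [h3] at h2
  refine h2.trans ?_
  rw [← h4]
  have : ‖WithLp.toLp 2 (A *ᵥ x)‖ ≤ ‖A‖ * ‖WithLp.toLp 2 x‖ := h
  nlinarith [norm_nonneg (WithLp.toLp 2 x)]

/-- The norm is the largest absolute eigenvalue, and each eigenvalue is the quadratic form at a unit
eigenvector. -/
lemma Matrix.IsHermitian.norm_le_of_abs_dotProduct_mulVec_le {A : Matrix d d ℝ}
    (hA : A.IsHermitian) {c : ℝ} (hc : 0 ≤ c) (h : ∀ x : d → ℝ, |x ⬝ᵥ A *ᵥ x| ≤ c * (x ⬝ᵥ x)) :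
    ‖A‖ ≤ c := by
  rw [hA.spectral_theorem, Unitary.conjStarAlgAut_apply, CStarRing.norm_mul_mem_unitary _
    (Unitary.star_mem (SetLike.coe_mem _)), CStarRing.norm_mem_unitary_mul _ (SetLike.coe_mem _),
    Matrix.l2_opNorm_diagonal, pi_norm_le_iff_of_nonneg hc]
  intro i
  have h1 := h (hA.eigenvectorBasis i)
  have h2 := hA.eigenvalues_eq i
  simp only [star_trivial, RCLike.re_to_real] at h2
  have h3 : (hA.eigenvectorBasis i : d → ℝ) ⬝ᵥ (hA.eigenvectorBasis i) = 1 := by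
    have := real_inner_self_eq_norm_mul_norm (hA.eigenvectorBasis i)
    rw [hA.eigenvectorBasis.orthonormal.1 i, EuclideanSpace.inner_eq_star_dotProduct] at this
    simpa using this
  rw [h3, ← h2] at h1
  simpa using h1

lemma Matrix.IsHermitian.norm_pow_le_trace {H : Matrix d d ℝ} (hH : H.IsHermitian) (r : ℕ)
    [Nonempty d] : ‖H‖ ^ (2 * r) ≤ (H ^ (2 * r)).trace := by
  have h0 : ‖H‖ = ‖hH.eigenvalues‖ := by
    conv_lhs => rw [hH.spectral_theorem, Unitary.conjStarAlgAut_apply,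
      CStarRing.norm_mul_mem_unitary _ (Unitary.star_mem (SetLike.coe_mem _)),
      CStarRing.norm_mem_unitary_mul _ (SetLike.coe_mem _), Matrix.l2_opNorm_diagonal]
    rfl
  have h1 : (H ^ (2 * r)).trace = ∑ i, hH.eigenvalues i ^ (2 * r) := by
    conv_lhs => rw [hH.spectral_theorem]
    rw [← map_pow, Matrix.diagonal_pow, Unitary.conjStarAlgAut_apply, Matrix.trace_mul_comm,
      ← Matrix.mul_assoc, Unitary.coe_star_mul_self, Matrix.one_mul, Matrix.trace_diagonal]
    rfl
  obtain ⟨i, hi⟩ := Finite.exists_max fun i => ‖hH.eigenvalues i‖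
  have h2 : ‖hH.eigenvalues‖ ≤ ‖hH.eigenvalues i‖ :=
    (pi_norm_le_iff_of_nonneg (norm_nonneg _)).2 hi
  rw [h0, h1]
  refine (pow_le_pow_left₀ (norm_nonneg _) h2 _).trans ?_
  rw [pow_mul, Real.norm_eq_abs, sq_abs, ← pow_mul]
  exact Finset.single_le_sum (f := fun i => hH.eigenvalues i ^ (2 * r))
    (fun j _ => (even_two_mul r).pow_nonneg _) (Finset.mem_univ i)

/-- In an eigenbasis of `H` only the diagonal of `V` contributes; its entries are at most `‖V‖`, and
even powers of eigenvalues are nonnegative weights. -/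
lemma Matrix.trace_mul_pow_le (V : Matrix d d ℝ) {H : Matrix d d ℝ} (hH : H.IsHermitian)
    (m : ℕ) : (V * H ^ (2 * m)).trace ≤ ‖V‖ * (H ^ (2 * m)).trace := by
  obtain ⟨U, l, hU⟩ := hH.exists_orthogonal_diagonalization
  have h1 : (H ^ (2 * m)).trace = ∑ i, l i ^ (2 * m) := by
    rw [hU, Matrix.trace_mul_comm, ← Matrix.mul_assoc, Matrix.unitaryGroup.transpose_mul_self,
      Matrix.one_mul, Matrix.trace_diagonal]
    rfl
  have h2 : (V * H ^ (2 * m)).trace =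
      ∑ i, ((U : Matrix d d ℝ)ᵀ * V * (U : Matrix d d ℝ)) i i * l i ^ (2 * m) := by
    rw [hU, ← Matrix.mul_assoc, Matrix.trace_mul_comm, ← Matrix.mul_assoc, ← Matrix.mul_assoc]
    simp only [Matrix.trace, Matrix.diag, Matrix.mul_diagonal]
    rfl
  rw [h1, h2, Finset.mul_sum]
  refine Finset.sum_le_sum fun i _ => mul_le_mul_of_nonneg_right ?_ ((even_two_mul m).pow_nonneg _)
  have h3 := Matrix.abs_dotProduct_mulVec_le ((U : Matrix d d ℝ)ᵀ * V * (U : Matrix d d ℝ))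
    (Pi.single i 1)
  have h4 : ‖(U : Matrix d d ℝ)ᵀ * V * (U : Matrix d d ℝ)‖ = ‖V‖ := by
    rw [CStarRing.norm_mul_mem_unitary _ (SetLike.coe_mem _)]
    exact CStarRing.norm_mem_unitary_mul _ (Unitary.star_mem (SetLike.coe_mem U))
  rw [h4] at h3
  simp only [Matrix.mulVec_single_one, single_one_dotProduct, Pi.single_eq_same, mul_one,
    Matrix.col_apply] at h3
  exact (le_abs_self _).trans h3

end MatrixInequalities

/-! ### Noncommutative Khintchine inequality by sign flipping. -/

section Rademacher

variable {ι : Type*} [Fintype ι] [DecidableEq ι]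

/-- The Rademacher sum `∑ i, ε i • A i`. -/
noncomputable def rademacherSum {E : Type*} [AddCommGroup E] [Module ℝ E] (A : ι → E) (ε : ι → ℤˣ) :
    E :=
  ∑ i, ((ε i : ℤ) : ℝ) • A i

/-- Flipping the `i`-th sign. -/
def flipSign (i : ι) : Equiv.Perm (ι → ℤˣ) :=
  Function.Involutive.toPerm (fun ε => Function.update ε i (-ε i)) fun ε => by
    ext j; by_cases h : j = i
    · subst h; simp
    · simp [h]

@[simp]
lemma flipSign_apply {ι : Type*} [DecidableEq ι] (i : ι) (ε : ι → ℤˣ) : flipSign i ε = Function.update ε i (-ε i) := rfl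

lemma Int.cast_units_mul_self (u : ℤˣ) : ((u : ℤ) : ℝ) * ((u : ℤ) : ℝ) = 1 := by
  rcases Int.units_eq_one_or u with h | h <;> simp [h]

lemma rademacherSum_sub_flipSign {E : Type*} [AddCommGroup E] [Module ℝ E] (A : ι → E)
    (ε : ι → ℤˣ) (i : ι) :
    rademacherSum A ε - rademacherSum A (flipSign i ε) = (2 * ((ε i : ℤ) : ℝ)) • A i := by
  unfold rademacherSum
  rw [← Finset.sum_sub_distrib, Finset.sum_eq_single i]
  · simp [two_mul, add_smul]
  · intro j _ hj
    simp [hj]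
  · simp

lemma isHermitian_rademacherSum {ι d : Type*} [Fintype ι] {A : ι → Matrix d d ℝ} (hA : ∀ i, (A i).IsHermitian)
    (ε : ι → ℤˣ) : (rademacherSum A ε).IsHermitian := by
  unfold rademacherSum Matrix.IsHermitian
  rw [Matrix.conjTranspose_sum]
  exact Finset.sum_congr rfl fun i _ => by
    rw [Matrix.conjTranspose_smul, (hA i).eq, star_trivial]

variable {d : Type*} [Fintype d] [DecidableEq d]

/-- Discrete Gaussian integration by parts: `ε` and its flip at `i` form an exchangeable pair whose
sums differ by `2 ε i • A i`, so the trace mean value inequality applies to each pair. -/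
lemma sum_sign_mul_trace_mul_pow_le {A : ι → Matrix d d ℝ} (hA : ∀ i, (A i).IsHermitian) (m : ℕ)
    (i : ι) :
    ∑ ε, ((ε i : ℤ) : ℝ) * (A i * rademacherSum A ε ^ (2 * m + 1)).trace ≤
      (2 * m + 1) * ∑ ε, (A i * A i * rademacherSum A ε ^ (2 * m)).trace := by
  set F : (ι → ℤˣ) → ℝ := fun ε =>
    ((ε i : ℤ) : ℝ) * (A i * rademacherSum A ε ^ (2 * m + 1)).trace
  set G : (ι → ℤˣ) → ℝ := fun ε => (A i * A i * rademacherSum A ε ^ (2 * m)).trace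
  have hF := Equiv.sum_comp (flipSign i) F
  have hG := Equiv.sum_comp (flipSign i) G
  have key (ε : ι → ℤˣ) :
      F ε + F (flipSign i ε) ≤ (2 * m + 1) * (G ε + G (flipSign i ε)) := by
    have h := (isHermitian_rademacherSum hA ε).trace_sub_mul_pow_sub_pow_le
      (isHermitian_rademacherSum hA (flipSign i ε)) m
    rw [rademacherSum_sub_flipSign] at h
    have hs : ((flipSign i ε i : ℤ) : ℝ) = - ((ε i : ℤ) : ℝ) := by simp
    simp only [Matrix.smul_mul, Matrix.mul_smul, Matrix.mul_sub, Matrix.trace_sub,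
      Matrix.trace_smul, smul_eq_mul] at h
    have hu := Int.cast_units_mul_self (ε i)
    simp only [F, G, hs]
    have e (x : ℝ) : 2 * ((ε i : ℤ) : ℝ) * (2 * ((ε i : ℤ) : ℝ) * x) = 4 * x := by
      linear_combination 4 * x * hu
    rw [e, e] at h
    linarith
  have := Finset.sum_le_sum fun ε (_ : ε ∈ Finset.univ) => key ε
  rw [← Finset.mul_sum, Finset.sum_add_distrib, Finset.sum_add_distrib, hF, hG] at this
  linarith

/-- Recursion for the even trace moments of a matrix Rademacher sum. -/
lemma sum_trace_rademacherSum_pow_succ_le {A : ι → Matrix d d ℝ} (hA : ∀ i, (A i).IsHermitian)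
    (m : ℕ) :
    ∑ ε, (rademacherSum A ε ^ (2 * (m + 1))).trace ≤
      (2 * m + 1) * ‖∑ i, A i * A i‖ * ∑ ε, (rademacherSum A ε ^ (2 * m)).trace := by
  calc ∑ ε, (rademacherSum A ε ^ (2 * (m + 1))).trace
      = ∑ ε, ∑ i, ((ε i : ℤ) : ℝ) * (A i * rademacherSum A ε ^ (2 * m + 1)).trace := by
        refine Finset.sum_congr rfl fun ε _ => ?_
        -- Expand just one factor of the power as a Rademacher sum.
        rw [show 2 * (m + 1) = (2 * m + 1) + 1 by ring, pow_succ']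
        conv_lhs => enter [1, 1]; unfold rademacherSum
        simp [Finset.sum_mul, Matrix.trace_sum]
    _ = ∑ i, ∑ ε, ((ε i : ℤ) : ℝ) * (A i * rademacherSum A ε ^ (2 * m + 1)).trace :=
        Finset.sum_comm
    _ ≤ ∑ i, (2 * m + 1) * ∑ ε, (A i * A i * rademacherSum A ε ^ (2 * m)).trace :=
        Finset.sum_le_sum fun i _ => sum_sign_mul_trace_mul_pow_le hA m i
    _ = (2 * m + 1) * ∑ ε, ((∑ i, A i * A i) * rademacherSum A ε ^ (2 * m)).trace := by
        rw [← Finset.mul_sum, Finset.sum_comm]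
        simp [Finset.sum_mul, Matrix.trace_sum]
    _ ≤ (2 * m + 1) * ∑ ε, ‖∑ i, A i * A i‖ * (rademacherSum A ε ^ (2 * m)).trace := by
        gcongr with ε
        exact Matrix.trace_mul_pow_le _ (isHermitian_rademacherSum hA ε) m
    _ = _ := by rw [← Finset.mul_sum]; ring

/-- Noncommutative Khintchine inequality for the even trace moments. -/
lemma sum_trace_rademacherSum_pow_le {A : ι → Matrix d d ℝ} (hA : ∀ i, (A i).IsHermitian)
    (r : ℕ) :
    ∑ ε, (rademacherSum A ε ^ (2 * r)).trace ≤
      Fintype.card (ι → ℤˣ) * Fintype.card d *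
        ((2 * r)! / (2 ^ r * r !) * ‖∑ i, A i * A i‖ ^ r) := by
  induction r with
  | zero => simp
  | succ r ih =>
    refine (sum_trace_rademacherSum_pow_succ_le hA r).trans ?_
    refine (mul_le_mul_of_nonneg_left ih (by positivity)).trans (le_of_eq ?_)
    rw [show 2 * (r + 1) = 2 * r + 1 + 1 by ring, Nat.factorial_succ, Nat.factorial_succ,
      Nat.factorial_succ]
    push_cast
    field_simp
    ring

/-- Exponential integrability of the norm of a matrix Rademacher sum. -/
theorem sum_exp_norm_rademacherSum_le [Nonempty d] {A : ι → Matrix d d ℝ}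
    (hA : ∀ i, (A i).IsHermitian) (s : ℝ) :
    ∑ ε, Real.exp (s * ‖rademacherSum A ε‖) ≤
      Fintype.card (ι → ℤˣ) *
        (2 * Fintype.card d * Real.exp (s ^ 2 * ‖∑ i, A i * A i‖ / 2)) := by
  -- The cosh series involves only even moments. Its `(2 * r)!` cancels the one in the Khintchine
  -- constant `(2r - 1)‼ = (2r)! / (2 ^ r * r !)`, leaving an exponential series.
  have hcosh : ∑ ε, Real.cosh (s * ‖rademacherSum A ε‖) ≤
      Fintype.card (ι → ℤˣ) * Fintype.card d * Real.exp (s ^ 2 * ‖∑ i, A i * A i‖ / 2) := by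
    have h1 := hasSum_sum fun ε (_ : ε ∈ (Finset.univ : Finset (ι → ℤˣ))) =>
      Real.hasSum_cosh (s * ‖rademacherSum A ε‖)
    have h2 : HasSum (fun r : ℕ => (s ^ 2 * ‖∑ i, A i * A i‖ / 2) ^ r / r !)
        (Real.exp (s ^ 2 * ‖∑ i, A i * A i‖ / 2)) := by
      rw [Real.exp_eq_exp_ℝ]
      exact NormedSpace.expSeries_div_hasSum_exp _
    refine hasSum_le (fun r => ?_) h1 (h2.mul_left _)
    have h3 : ∑ ε, ‖rademacherSum A ε‖ ^ (2 * r) ≤ _ :=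
      (Finset.sum_le_sum fun ε _ => (isHermitian_rademacherSum hA ε).norm_pow_le_trace r).trans
        (sum_trace_rademacherSum_pow_le hA r)
    calc ∑ ε, (s * ‖rademacherSum A ε‖) ^ (2 * r) / ((2 * r)! : ℝ)
        = s ^ (2 * r) / ((2 * r)! : ℝ) * ∑ ε, ‖rademacherSum A ε‖ ^ (2 * r) := by
          rw [Finset.mul_sum]
          exact Finset.sum_congr rfl fun ε _ => by rw [mul_pow]; ring
      _ ≤ _ := mul_le_mul_of_nonneg_left h3
          (div_nonneg ((even_two_mul r).pow_nonneg _) (by positivity))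
      _ = _ := by
          rw [div_pow, mul_pow, ← pow_mul]
          field_simp
  calc ∑ ε, Real.exp (s * ‖rademacherSum A ε‖)
      ≤ ∑ ε, 2 * Real.cosh (s * ‖rademacherSum A ε‖) := by
        refine Finset.sum_le_sum fun ε _ => ?_
        rw [Real.cosh_eq]
        linarith [Real.exp_pos (-(s * ‖rademacherSum A ε‖))]
    _ = 2 * ∑ ε, Real.cosh (s * ‖rademacherSum A ε‖) := by rw [Finset.mul_sum]
    _ ≤ _ := by linarith

end Rademacher

/-! ### Exchanging coordinates of two independent copies. -/

section Swap

variable {Ω ι E : Type*} [MeasurableSpace Ω] [MeasurableSpace E]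

/-- Exchange the `i`-th coordinates of the two families whenever `ε i ≠ 1`. -/
def swapCoordinates (ε : ι → ℤˣ) (z : (ι → E) × (ι → E)) : (ι → E) × (ι → E) :=
  (fun i => if ε i = 1 then z.1 i else z.2 i, fun i => if ε i = 1 then z.2 i else z.1 i)

lemma measurePreserving_swapCoordinates [Fintype ι] (ν : ι → Measure E)
    [∀ i, IsProbabilityMeasure (ν i)] (ε : ι → ℤˣ) :
    MeasurePreserving (swapCoordinates ε) ((Measure.pi ν).prod (Measure.pi ν))
      ((Measure.pi ν).prod (Measure.pi ν)) := by
  have he := measurePreserving_arrowProdEquivProdArrow E E ι ν ν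
  set f : ι → E × E → E × E := fun i z => if ε i = 1 then z else z.swap
  have hf (i : ι) : MeasurePreserving (f i) ((ν i).prod (ν i)) ((ν i).prod (ν i)) := by
    by_cases h : ε i = 1
    · have : f i = id := by funext z; simp [f, h]
      exact this ▸ MeasurePreserving.id _
    · simpa [f, h] using Measure.measurePreserving_swap
  have hpi : MeasurePreserving (fun (z : ι → E × E) i => f i (z i))
      (Measure.pi fun i => (ν i).prod (ν i)) (Measure.pi fun i => (ν i).prod (ν i)) :=
    measurePreserving_pi _ _ hf
  have h := he.comp (hpi.comp (he.symm _))
  convert h using 1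
  funext z
  ext i <;> by_cases h : ε i = 1 <;>
    simp [swapCoordinates, f, h, MeasurableEquiv.arrowProdEquivProdArrow,
      Equiv.arrowProdEquivProdArrow]

/-- Two independent copies of an independent family may exchange some of their coordinates. -/
lemma integral_prod_comp_swapCoordinates [Fintype ι] {μ : Measure Ω} [IsProbabilityMeasure μ]
    {Y : Ω → ι → E} (hY : Measurable Y) (hind : iIndepFun (fun i ω => Y ω i) μ) (ε : ι → ℤˣ)
    {G : (ι → E) × (ι → E) → ℝ} (hG : Measurable G) :
    ∫ z, G (Y z.1, Y z.2) ∂(μ.prod μ) =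
      ∫ z, G (swapCoordinates ε (Y z.1, Y z.2)) ∂(μ.prod μ) := by
  have hYi (i : ι) : Measurable fun ω => Y ω i := (measurable_pi_apply i).comp hY
  have (i : ι) : IsProbabilityMeasure (μ.map fun ω => Y ω i) :=
    Measure.isProbabilityMeasure_map (hYi i).aemeasurable
  have hlaw : μ.map Y = Measure.pi fun i => μ.map fun ω => Y ω i :=
    hind.map_fun_eq_pi_map fun i => (hYi i).aemeasurable
  have hsw := measurePreserving_swapCoordinates (fun i => μ.map fun ω => Y ω i) ε
  rw [← hlaw, Measure.map_prod_map _ _ hY hY] at hsw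
  have hP : Measurable (Prod.map Y Y) := hY.prodMap hY
  have h1 : ∫ z, G (Y z.1, Y z.2) ∂(μ.prod μ) = ∫ x, G x ∂((μ.prod μ).map (Prod.map Y Y)) :=
    (integral_map hP.aemeasurable hG.aestronglyMeasurable).symm
  have h2 : ∫ z, G (swapCoordinates ε (Y z.1, Y z.2)) ∂(μ.prod μ) =
      ∫ x, G (swapCoordinates ε x) ∂((μ.prod μ).map (Prod.map Y Y)) :=
    (integral_map hP.aemeasurable (hG.comp hsw.measurable).aestronglyMeasurable).symm
  rw [h1, h2]
  conv_lhs => rw [← hsw.map_eq]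
  exact integral_map hsw.measurable.aemeasurable hG.aestronglyMeasurable

/-- Continuous functions are bounded on compact balls; this settles integrability throughout the
symmetrization and moment bounds. -/
lemma integrable_comp_of_continuous_of_norm_le {F : Type*} [NormedAddCommGroup F] [ProperSpace F]
    [MeasurableSpace F] [OpensMeasurableSpace F] {μ : Measure Ω} [IsFiniteMeasure μ] {Y : Ω → F}
    (hY : Measurable Y) {C : ℝ} (hC : ∀ ω, ‖Y ω‖ ≤ C) {g : F → ℝ} (hg : Continuous g) :
    Integrable (fun ω => g (Y ω)) μ := by
  obtain ⟨M, hM⟩ := (isCompact_closedBall (0 : F) C).exists_bound_of_continuousOn hg.continuousOn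
  exact Integrable.of_bound (hg.measurable.comp hY).aestronglyMeasurable M
    (Filter.Eventually.of_forall fun ω => hM _ (by simpa using hC ω))

end Swap

/-! ### Sums of rank one matrices. -/

section RankOne

variable {ι d : Type*} [Fintype ι] [Fintype d] [DecidableEq d]

/-- The rank one matrices `y i (y i)ᵀ`. -/
def rankOne (y : ι → d → ℝ) (i : ι) : Matrix d d ℝ := Matrix.vecMulVec (y i) (y i)

lemma isHermitian_rankOne {ι d : Type*} (y : ι → d → ℝ) (i : ι) : (rankOne y i).IsHermitian := by
  ext j k; simp [rankOne, Matrix.vecMulVec_apply, mul_comm]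

lemma rankOne_mulVec {ι d : Type*} [Fintype d] (y : ι → d → ℝ) (i : ι) (x : d → ℝ) :
    rankOne y i *ᵥ x = (y i ⬝ᵥ x) • y i := by
  rw [rankOne, Matrix.vecMulVec_mulVec, op_smul_eq_smul]

lemma dotProduct_sum_rankOne_mulVec {ι d : Type*} [Fintype ι] [Fintype d] (y : ι → d → ℝ) (x : d → ℝ) :
    x ⬝ᵥ (∑ i, rankOne y i) *ᵥ x = ∑ i, (y i ⬝ᵥ x) ^ 2 := by
  rw [Matrix.sum_mulVec, dotProduct_sum]
  refine Finset.sum_congr rfl fun i _ => ?_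
  rw [rankOne_mulVec, dotProduct_smul, dotProduct_comm x, sq, smul_eq_mul]

/-- Since `(y yᵀ)² = (y ⬝ᵥ y) y yᵀ`, the quadratic forms of the two sums compare term by term. This
makes the moment estimate self-bounding. -/
lemma norm_sum_rankOne_sq_le (y : ι → d → ℝ) {B : ℝ} (hB0 : 0 ≤ B) (hB : ∀ i, y i ⬝ᵥ y i ≤ B) :
    ‖∑ i, rankOne y i * rankOne y i‖ ≤ B * ‖∑ i, rankOne y i‖ := by
  have hH : (∑ i, rankOne y i * rankOne y i).IsHermitian := by
    rw [Matrix.IsHermitian, Matrix.conjTranspose_sum]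
    exact Finset.sum_congr rfl fun i _ => by
      rw [Matrix.conjTranspose_mul, (isHermitian_rankOne y i).eq]
  refine hH.norm_le_of_abs_dotProduct_mulVec_le (by positivity) fun x => ?_
  have h1 : x ⬝ᵥ (∑ i, rankOne y i * rankOne y i) *ᵥ x =
      ∑ i, (y i ⬝ᵥ y i) * (y i ⬝ᵥ x) ^ 2 := by
    rw [Matrix.sum_mulVec, dotProduct_sum]
    refine Finset.sum_congr rfl fun i _ => ?_
    rw [← Matrix.mulVec_mulVec, rankOne_mulVec, rankOne_mulVec, dotProduct_smul, dotProduct_smul,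
      dotProduct_comm x, smul_eq_mul, smul_eq_mul]
    ring
  have hn (i : ι) : 0 ≤ y i ⬝ᵥ y i := Finset.sum_nonneg fun j _ => mul_self_nonneg _
  rw [h1, abs_of_nonneg (Finset.sum_nonneg fun i _ => mul_nonneg (hn i) (sq_nonneg _))]
  calc _ ≤ ∑ i, B * (y i ⬝ᵥ x) ^ 2 :=
        Finset.sum_le_sum fun i _ => mul_le_mul_of_nonneg_right (hB i) (sq_nonneg _)
    _ = B * (x ⬝ᵥ (∑ i, rankOne y i) *ᵥ x) := by
        rw [← Finset.mul_sum, dotProduct_sum_rankOne_mulVec]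
    _ ≤ B * (‖∑ i, rankOne y i‖ * (x ⬝ᵥ x)) :=
        mul_le_mul_of_nonneg_left
          ((le_abs_self _).trans (Matrix.abs_dotProduct_mulVec_le _ _)) hB0
    _ = _ := by ring

lemma continuous_rankOne {ι d : Type*} (i : ι) : Continuous fun y : ι → d → ℝ => rankOne y i :=
  (continuous_apply i).matrix_vecMulVec (continuous_apply i)

lemma sum_rankOne_sub_sum_rankOne_swapCoordinates {ι d : Type*} [Fintype ι] (ε : ι → ℤˣ)
    (z : (ι → d → ℝ) × (ι → d → ℝ)) :
    ∑ i, rankOne (swapCoordinates ε z).1 i - ∑ i, rankOne (swapCoordinates ε z).2 i =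
      rademacherSum (rankOne z.1) ε - rademacherSum (rankOne z.2) ε := by
  unfold rademacherSum
  rw [← Finset.sum_sub_distrib, ← Finset.sum_sub_distrib]
  refine Finset.sum_congr rfl fun i _ => ?_
  rcases Int.units_eq_one_or (ε i) with h | h
  · simp [rankOne, swapCoordinates, h]
  · have : (-1 : ℤˣ) ≠ 1 := by decide
    simp only [rankOne, swapCoordinates, h, this, if_false]
    simp [neg_add_eq_sub]

end RankOne

/-! ### Symmetrization, self-bounding exponential moments and the Chernoff bound. -/

section SelfBounding

variable {Ω ι d : Type*} [MeasurableSpace Ω] [Fintype ι] [Fintype d] [DecidableEq d]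
  {μ : Measure Ω} [IsProbabilityMeasure μ] {Y : Ω → ι → d → ℝ} {C N : ℝ}

lemma continuous_sum_rankOne {ι d : Type*} [Fintype ι] : Continuous fun y : ι → d → ℝ => ∑ i, rankOne y i :=
  continuous_finsetSum _ fun i _ => continuous_rankOne i

lemma continuous_rademacherSum_rankOne {ι d : Type*} [Fintype ι] (ε : ι → ℤˣ) :
    Continuous fun y : ι → d → ℝ => rademacherSum (rankOne y) ε :=
  continuous_finsetSum _ fun i _ => (continuous_const_smul (((ε i : ℤ) : ℝ))).comp (continuous_rankOne i)

/-- The deviation of a sum of rank one matrices from its mean is dominated by the average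
distance to an independent copy. -/
lemma norm_sum_rankOne_sub_le_integral (hY : Measurable Y) (hC : ∀ ω, ‖Y ω‖ ≤ C)
    (hiso : ∀ x : d → ℝ, ∑ i, ∫ ω, (Y ω i ⬝ᵥ x) ^ 2 ∂μ = N * (x ⬝ᵥ x)) (y : ι → d → ℝ) :
    ‖∑ i, rankOne y i - N • (1 : Matrix d d ℝ)‖ ≤
      ∫ ω, ‖∑ i, rankOne y i - ∑ i, rankOne (Y ω) i‖ ∂μ := by
  have hH : (∑ i, rankOne y i - N • (1 : Matrix d d ℝ)).IsHermitian := by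
    refine Matrix.IsHermitian.sub ?_ ?_
    · rw [Matrix.IsHermitian, Matrix.conjTranspose_sum]
      exact Finset.sum_congr rfl fun i _ => isHermitian_rankOne y i
    · rw [Matrix.IsHermitian, Matrix.conjTranspose_smul, Matrix.conjTranspose_one, star_trivial]
  have hnorm : Integrable (fun ω => ‖∑ i, rankOne y i - ∑ i, rankOne (Y ω) i‖) μ :=
    integrable_comp_of_continuous_of_norm_le (g := fun y' : ι → d → ℝ =>
      ‖∑ i, rankOne y i - ∑ i, rankOne y' i‖) hY hC
      (continuous_const.sub continuous_sum_rankOne).norm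
  refine hH.norm_le_of_abs_dotProduct_mulVec_le (integral_nonneg fun _ => norm_nonneg _)
    fun x => ?_
  have hsq (i : ι) : Integrable (fun ω => (Y ω i ⬝ᵥ x) ^ 2) μ :=
    integrable_comp_of_continuous_of_norm_le (g := fun y' : ι → d → ℝ => (y' i ⬝ᵥ x) ^ 2) hY hC
      (by unfold dotProduct; fun_prop)
  -- By `hiso`, `N • 1` has the quadratic form of the mean of `∑ i, rankOne (Y ω) i`. Working with
  -- quadratic forms needs only scalar integrals.
  have h1 : x ⬝ᵥ (∑ i, rankOne y i - N • (1 : Matrix d d ℝ)) *ᵥ x =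
      ∫ ω, x ⬝ᵥ (∑ i, rankOne y i - ∑ i, rankOne (Y ω) i) *ᵥ x ∂μ := by
    simp_rw [Matrix.sub_mulVec, dotProduct_sub, dotProduct_sum_rankOne_mulVec]
    rw [integral_sub (integrable_const _) (integrable_finsetSum _ fun i _ => hsq i),
      integral_finsetSum _ fun i _ => hsq i, hiso, Matrix.smul_mulVec, Matrix.one_mulVec]
    simp
  rw [h1, ← integral_mul_const]
  refine (abs_integral_le_integral_abs).trans (integral_mono_of_nonneg
    (Filter.Eventually.of_forall fun _ => abs_nonneg _) (hnorm.mul_const _)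
    (Filter.Eventually.of_forall fun ω => Matrix.abs_dotProduct_mulVec_le _ _))

lemma sq_integral_le_integral_sq {f : Ω → ℝ} (hf : Integrable f μ)
    (hf2 : Integrable (fun ω => f ω ^ 2) μ) : (∫ ω, f ω ∂μ) ^ 2 ≤ ∫ ω, f ω ^ 2 ∂μ :=
  (even_two.convexOn_pow (𝕜 := ℝ)).map_integral_le (continuous_pow 2).continuousOn isClosed_univ
    (Filter.Eventually.of_forall fun _ => Set.mem_univ _) hf hf2

lemma exp_integral_le_integral_exp {f : Ω → ℝ} (hf : Integrable f μ)
    (hf2 : Integrable (fun ω => Real.exp (f ω)) μ) :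
    Real.exp (∫ ω, f ω ∂μ) ≤ ∫ ω, Real.exp (f ω) ∂μ :=
  convexOn_exp.map_integral_le Real.continuous_exp.continuousOn isClosed_univ
    (Filter.Eventually.of_forall fun _ => Set.mem_univ _) hf hf2

/-- Symmetrization of the exponential moments. -/
lemma integral_exp_norm_sum_rankOne_le_rademacher (hY : Measurable Y)
    (hind : iIndepFun (fun i ω => Y ω i) μ) (hC : ∀ ω, ‖Y ω‖ ≤ C)
    (hiso : ∀ x : d → ℝ, ∑ i, ∫ ω, (Y ω i ⬝ᵥ x) ^ 2 ∂μ = N * (x ⬝ᵥ x)) {s : ℝ} (hs : 0 ≤ s)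
    (ε : ι → ℤˣ) :
    ∫ ω, Real.exp (s * ‖∑ i, rankOne (Y ω) i - N • (1 : Matrix d d ℝ)‖) ∂μ ≤
      ∫ ω, Real.exp (2 * s * ‖rademacherSum (rankOne (Y ω)) ε‖) ∂μ := by
  set T : (ι → d → ℝ) → Matrix d d ℝ := fun y => ∑ i, rankOne y i with hT
  set R : (ι → d → ℝ) → Matrix d d ℝ := fun y => rademacherSum (rankOne y) ε with hR
  have cT : Continuous T := continuous_sum_rankOne
  have cR : Continuous R := continuous_rademacherSum_rankOne ε
  have hP : Measurable fun z : Ω × Ω => (Y z.1, Y z.2) :=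
    (hY.comp measurable_fst).prodMk (hY.comp measurable_snd)
  have hPC (z : Ω × Ω) : ‖(Y z.1, Y z.2)‖ ≤ C := max_le (hC _) (hC _)
  set G : (ι → d → ℝ) × (ι → d → ℝ) → ℝ := fun z => Real.exp (s * ‖T z.1 - T z.2‖) with hG
  have cG : Continuous G := Real.continuous_exp.comp
    (continuous_const.mul ((cT.comp continuous_fst).sub (cT.comp continuous_snd)).norm)
  have iG : Integrable (fun z : Ω × Ω => G (Y z.1, Y z.2)) (μ.prod μ) :=
    integrable_comp_of_continuous_of_norm_le hP hPC cG
  have iR : Integrable (fun ω => Real.exp (2 * s * ‖R (Y ω)‖)) μ :=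
    integrable_comp_of_continuous_of_norm_le (g := fun y => Real.exp (2 * s * ‖R y‖)) hY hC
      (Real.continuous_exp.comp (continuous_const.mul cR.norm))
  have iGω (y : ι → d → ℝ) : Integrable (fun ω => G (y, Y ω)) μ :=
    integrable_comp_of_continuous_of_norm_le (g := fun y' => G (y, y')) hY hC
      (cG.comp (continuous_const.prodMk continuous_id))
  have iN (y : ι → d → ℝ) : Integrable (fun ω => s * ‖T y - T (Y ω)‖) μ :=
    integrable_comp_of_continuous_of_norm_le (g := fun y' => s * ‖T y - T y'‖) hY hC
      (continuous_const.mul (continuous_const.sub cT).norm)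
  have iS : Integrable (fun ω => Real.exp (s * ‖T (Y ω) - N • (1 : Matrix d d ℝ)‖)) μ :=
    integrable_comp_of_continuous_of_norm_le
      (g := fun y => Real.exp (s * ‖T y - N • (1 : Matrix d d ℝ)‖)) hY hC
      (Real.continuous_exp.comp (continuous_const.mul (cT.sub continuous_const).norm))
  calc ∫ ω, Real.exp (s * ‖T (Y ω) - N • (1 : Matrix d d ℝ)‖) ∂μ
      ≤ ∫ ω, ∫ ω', G (Y ω, Y ω') ∂μ ∂μ := by
        -- Jensen in the independent copy `ω'`, with `ω` fixed.
        refine integral_mono iS iG.integral_prod_left fun ω => ?_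
        refine le_trans (Real.exp_le_exp.2 ?_) (exp_integral_le_integral_exp (iN (Y ω)) (iGω (Y ω)))
        rw [integral_const_mul]
        exact mul_le_mul_of_nonneg_left (norm_sum_rankOne_sub_le_integral hY hC hiso (Y ω)) hs
    _ = ∫ z, G (Y z.1, Y z.2) ∂(μ.prod μ) := (integral_prod _ iG).symm
    _ = ∫ z, G (swapCoordinates ε (Y z.1, Y z.2)) ∂(μ.prod μ) :=
        integral_prod_comp_swapCoordinates hY hind ε cG.measurable
    _ = ∫ z, Real.exp (s * ‖R (Y z.1) - R (Y z.2)‖) ∂(μ.prod μ) := by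
        simp only [hG, hT, hR, sum_rankOne_sub_sum_rankOne_swapCoordinates]
    _ ≤ ∫ z, (Real.exp (2 * s * ‖R (Y z.1)‖) / 2 + Real.exp (2 * s * ‖R (Y z.2)‖) / 2)
          ∂(μ.prod μ) := by
        refine integral_mono_of_nonneg (Filter.Eventually.of_forall fun _ => (Real.exp_pos _).le)
          (((iR.comp_fst μ).div_const 2).add ((iR.comp_snd μ).div_const 2))
          (Filter.Eventually.of_forall fun z => ?_)
        have h1 : s * ‖R (Y z.1) - R (Y z.2)‖ ≤ s * ‖R (Y z.1)‖ + s * ‖R (Y z.2)‖ := by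
          rw [← mul_add]; exact mul_le_mul_of_nonneg_left (norm_sub_le _ _) hs
        have h2 (a : ℝ) : Real.exp (2 * s * a) = Real.exp (s * a) ^ 2 := by
          rw [sq, ← Real.exp_add]; ring_nf
        refine (Real.exp_le_exp.2 h1).trans ?_
        simp only [h2]
        -- `2xy ≤ x² + y²` decouples the two copies at the cost of doubling `s`.
        rw [Real.exp_add]
        nlinarith [sq_nonneg (Real.exp (s * ‖R (Y z.1)‖) - Real.exp (s * ‖R (Y z.2)‖))]
    _ = ∫ ω, Real.exp (2 * s * ‖R (Y ω)‖) ∂μ := by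
        rw [integral_add ((iR.comp_fst μ).div_const 2) ((iR.comp_snd μ).div_const 2),
          integral_div, integral_div,
          integral_fun_fst (fun ω => Real.exp (2 * s * ‖R (Y ω)‖)),
          integral_fun_snd (fun ω => Real.exp (2 * s * ‖R (Y ω)‖))]
        simp

/-- Exponential moment bound for the deviation of a sum of independent rank one matrices in
isotropic position. -/
theorem integral_exp_norm_sum_rankOne_sub_le [Nonempty d] (hY : Measurable Y)
    (hind : iIndepFun (fun i ω => Y ω i) μ) (hC : ∀ ω, ‖Y ω‖ ≤ C)
    (hiso : ∀ x : d → ℝ, ∑ i, ∫ ω, (Y ω i ⬝ᵥ x) ^ 2 ∂μ = N * (x ⬝ᵥ x)) (hN : 0 ≤ N)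
    {B : ℝ} (hB0 : 0 ≤ B) (hB : ∀ ω i, Y ω i ⬝ᵥ Y ω i ≤ B) {s : ℝ} (hs : 0 ≤ s)
    (hsB : 4 * s * B ≤ 1) :
    ∫ ω, Real.exp (s * ‖∑ i, rankOne (Y ω) i - N • (1 : Matrix d d ℝ)‖) ∂μ ≤
      (2 * Fintype.card d * Real.exp (2 * s ^ 2 * B * N)) ^ 2 := by
  classical
  set D : Ω → ℝ := fun ω => ‖∑ i, rankOne (Y ω) i - N • (1 : Matrix d d ℝ)‖ with hD
  have iD (a : ℝ) : Integrable (fun ω => Real.exp (a * D ω)) μ :=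
    integrable_comp_of_continuous_of_norm_le
      (g := fun y => Real.exp (a * ‖∑ i, rankOne y i - N • (1 : Matrix d d ℝ)‖)) hY hC
      (Real.continuous_exp.comp
        (continuous_const.mul (continuous_sum_rankOne.sub continuous_const).norm))
  have iR (ε : ι → ℤˣ) : Integrable
      (fun ω => Real.exp (2 * s * ‖rademacherSum (rankOne (Y ω)) ε‖)) μ :=
    integrable_comp_of_continuous_of_norm_le
      (g := fun y => Real.exp (2 * s * ‖rademacherSum (rankOne y) ε‖)) hY hC
      (Real.continuous_exp.comp
        (continuous_const.mul (continuous_rademacherSum_rankOne ε).norm))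
  set c : ℝ := 2 * Fintype.card d * Real.exp (2 * s ^ 2 * B * N) with hc
  have hc0 : 0 < c := by positivity
  set M := ∫ ω, Real.exp (s * D ω) ∂μ with hM
  set m := ∫ ω, Real.exp (s / 2 * D ω) ∂μ with hm
  have hM0 : 0 < M := integral_exp_pos (iD s)
  have hm0 : 0 < m := integral_exp_pos (iD (s / 2))
  have hcard : (0 : ℝ) < Fintype.card (ι → ℤˣ) := by exact_mod_cast Fintype.card_pos
  have hpt (ω : Ω) : ∑ ε, Real.exp (2 * s * ‖rademacherSum (rankOne (Y ω)) ε‖) ≤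
      Fintype.card (ι → ℤˣ) * (c * Real.exp (s / 2 * D ω)) := by
    refine (sum_exp_norm_rademacherSum_le (isHermitian_rankOne (Y ω)) (2 * s)).trans ?_
    refine mul_le_mul_of_nonneg_left ?_ hcard.le
    rw [hc, mul_assoc (2 * (Fintype.card d : ℝ)), ← Real.exp_add]
    refine mul_le_mul_of_nonneg_left (Real.exp_le_exp.2 ?_) (by positivity)
    have h1 := norm_sum_rankOne_sq_le (Y ω) hB0 (hB ω)
    have h2 : ‖∑ i, rankOne (Y ω) i‖ ≤ D ω + N := by
      have := norm_add_le (∑ i, rankOne (Y ω) i - N • (1 : Matrix d d ℝ))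
        (N • (1 : Matrix d d ℝ))
      rw [sub_add_cancel, norm_smul, norm_one, mul_one, Real.norm_of_nonneg hN] at this
      exact this
    have h3 : ‖∑ i, rankOne (Y ω) i * rankOne (Y ω) i‖ ≤ B * (D ω + N) :=
      h1.trans (mul_le_mul_of_nonneg_left h2 hB0)
    have h4 : 0 ≤ D ω := norm_nonneg _
    -- The exponent is at most `2 s² B (D + N)`, and `4 s B ≤ 1` turns `2 s² B D` into `s D / 2`.
    nlinarith [mul_le_mul_of_nonneg_left h3 (sq_nonneg s),
      mul_le_mul_of_nonneg_left hsB (mul_nonneg hs h4)]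
  have h1 : M ≤ c * m := by
    have h2 : Fintype.card (ι → ℤˣ) * M ≤ Fintype.card (ι → ℤˣ) * (c * m) := by
      calc Fintype.card (ι → ℤˣ) * M = ∑ _ε : ι → ℤˣ, M := by simp
        _ ≤ ∑ ε, ∫ ω, Real.exp (2 * s * ‖rademacherSum (rankOne (Y ω)) ε‖) ∂μ :=
            Finset.sum_le_sum fun ε _ =>
              integral_exp_norm_sum_rankOne_le_rademacher hY hind hC hiso hs ε
        _ = ∫ ω, ∑ ε, Real.exp (2 * s * ‖rademacherSum (rankOne (Y ω)) ε‖) ∂μ :=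
            (integral_finsetSum _ fun ε _ => iR ε).symm
        _ ≤ ∫ ω, Fintype.card (ι → ℤˣ) * (c * Real.exp (s / 2 * D ω)) ∂μ :=
            integral_mono (integrable_finsetSum _ fun ε _ => iR ε)
              (((iD _).const_mul _).const_mul _) hpt
        _ = _ := by rw [integral_const_mul, integral_const_mul]
    exact le_of_mul_le_mul_left h2 hcard
  have h2 : m ^ 2 ≤ M := by
    have e (ω : Ω) : Real.exp (s / 2 * D ω) ^ 2 = Real.exp (s * D ω) := by
      rw [sq, ← Real.exp_add]; ring_nf
    have := sq_integral_le_integral_sq (iD (s / 2)) (by simpa only [e] using iD s)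
    simpa only [e] using this
  -- The bound closes on itself: `M² ≤ c² m² ≤ c² M`, where `M` is finite and positive.
  have h3 : M * M ≤ c ^ 2 * M := by nlinarith
  exact le_of_mul_le_mul_right h3 hM0

/-- Chernoff bound for the deviation of a sum of independent rank one matrices. -/
theorem measure_le_norm_sum_rankOne_sub_le [Nonempty d] (hY : Measurable Y)
    (hind : iIndepFun (fun i ω => Y ω i) μ) (hC : ∀ ω, ‖Y ω‖ ≤ C)
    (hiso : ∀ x : d → ℝ, ∑ i, ∫ ω, (Y ω i ⬝ᵥ x) ^ 2 ∂μ = N * (x ⬝ᵥ x)) (hN : 0 ≤ N)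
    {B : ℝ} (hB0 : 0 ≤ B) (hB : ∀ ω i, Y ω i ⬝ᵥ Y ω i ≤ B) {s : ℝ} (hs : 0 ≤ s)
    (hsB : 4 * s * B ≤ 1) (u : ℝ) :
    μ {ω | u ≤ ‖∑ i, rankOne (Y ω) i - N • (1 : Matrix d d ℝ)‖} ≤
      ENNReal.ofReal (Real.exp (-s * u) *
        (2 * Fintype.card d * Real.exp (2 * s ^ 2 * B * N)) ^ 2) := by
  have hint : Integrable (fun ω => Real.exp (s *
      ‖∑ i, rankOne (Y ω) i - N • (1 : Matrix d d ℝ)‖)) μ :=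
    integrable_comp_of_continuous_of_norm_le
      (g := fun y => Real.exp (s * ‖∑ i, rankOne y i - N • (1 : Matrix d d ℝ)‖)) hY hC
      (Real.continuous_exp.comp
        (continuous_const.mul (continuous_sum_rankOne.sub continuous_const).norm))
  rw [← ofReal_measureReal]
  refine ENNReal.ofReal_le_ofReal ((measure_ge_le_exp_mul_mgf u hs hint).trans ?_)
  exact mul_le_mul_of_nonneg_left
    (integral_exp_norm_sum_rankOne_sub_le hY hind hC hiso hN hB0 hB hs hsB) (Real.exp_pos _).le

end SelfBounding

/-! ### Whitening of a positive definite matrix. -/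

section Whitening

/-- A positive definite matrix becomes the identity in a suitable basis. -/
lemma Matrix.PosDef.exists_whitening {d : Type*} [Fintype d] [DecidableEq d] {S : Matrix d d ℝ}
    (hS : S.PosDef) :
    ∃ W V : Matrix d d ℝ, W * V = 1 ∧ ∀ x : d → ℝ, (W *ᵥ x) ⬝ᵥ S *ᵥ (W *ᵥ x) = x ⬝ᵥ x := by
  set l := hS.1.eigenvalues with hl
  set U : Matrix d d ℝ := hS.1.eigenvectorUnitary.1 with hU
  have hl0 (i : d) : 0 < l i := hS.eigenvalues_pos i
  have hUU : U * Uᵀ = 1 := Matrix.unitaryGroup.mul_transpose_self _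
  have hUU' : Uᵀ * U = 1 := Matrix.unitaryGroup.transpose_mul_self _
  have hSU : S = U * Matrix.diagonal l * Uᵀ := hS.1.spectral_theorem
  set D := Matrix.diagonal fun i => (Real.sqrt (l i))⁻¹ with hD
  set D' := Matrix.diagonal fun i => Real.sqrt (l i) with hD'
  have hDD : D * D' = 1 := by
    rw [hD, hD', Matrix.diagonal_mul_diagonal, ← Matrix.diagonal_one]
    congr 1
    funext i
    exact inv_mul_cancel₀ (Real.sqrt_pos.2 (hl0 i)).ne'
  refine ⟨U * D, D' * Uᵀ, ?_, fun x => ?_⟩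
  · rw [Matrix.mul_assoc, ← Matrix.mul_assoc D, hDD, Matrix.one_mul, hUU]
  · have h1 : (U * D)ᵀ * (S * (U * D)) = 1 := by
      calc (U * D)ᵀ * (S * (U * D)) = D * (Uᵀ * U) * Matrix.diagonal l * (Uᵀ * U) * D := by
            rw [hSU, Matrix.transpose_mul, hD, Matrix.diagonal_transpose]
            simp only [Matrix.mul_assoc]
        _ = 1 := by
            rw [hUU', Matrix.mul_one, Matrix.mul_one, hD, Matrix.diagonal_mul_diagonal,
              Matrix.diagonal_mul_diagonal, ← Matrix.diagonal_one]
            congr 1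
            funext i
            have h2 := Real.mul_self_sqrt (hl0 i).le
            have h3 := (Real.sqrt_pos.2 (hl0 i)).ne'
            field_simp
            nlinarith
    rw [Matrix.mulVec_mulVec, Matrix.dotProduct_mulVec, ← Matrix.mulVec_transpose,
      Matrix.mulVec_mulVec]
    have h2 : (S * (U * D))ᵀ * (U * D) = 1 := by
      rw [← Matrix.transpose_one, ← h1, Matrix.transpose_mul (U * D)ᵀ, Matrix.transpose_transpose]
    rw [h2, Matrix.one_mulVec]

end Whitening

/-! ### The Gram matrix and its smallest eigenvalue. -/

namespace EmpiricalNorm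

variable {Ω : Type*} [MeasurableSpace Ω] {μ : Measure Ω} {n p : ℕ} {X : Fin n → Ω → Fin p → ℝ}

lemma linFun_eq_dotProduct (β : EuclideanSpace ℝ (Fin p)) (x : Fin p → ℝ) :
    linFun β x = x ⬝ᵥ β.ofLp := rfl

lemma theoNorm_sq (X : Fin n → Ω → Fin p → ℝ) (f : (Fin p → ℝ) → ℝ) :
    theoNorm μ X f ^ 2 = (∑ i, ∫ ω, f (X i ω) ^ 2 ∂μ) / n :=
  Real.sq_sqrt (div_nonneg (Finset.sum_nonneg fun _ _ => integral_nonneg fun _ => sq_nonneg _)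
    n.cast_nonneg)

lemma empNorm_sq {Ω : Type*} {n p : ℕ} (X : Fin n → Ω → Fin p → ℝ) (f : (Fin p → ℝ) → ℝ) (ω : Ω) :
    empNorm X f ω ^ 2 = (∑ i, f (X i ω) ^ 2) / n :=
  Real.sq_sqrt (div_nonneg (Finset.sum_nonneg fun _ _ => sq_nonneg _) n.cast_nonneg)

lemma theoNorm_sq_smul (X : Fin n → Ω → Fin p → ℝ) (c : ℝ) (β : EuclideanSpace ℝ (Fin p)) :
    theoNorm μ X (linFun (c • β)) ^ 2 = c ^ 2 * theoNorm μ X (linFun β) ^ 2 := by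
  rw [theoNorm_sq, theoNorm_sq, mul_div_assoc', Finset.mul_sum]
  congr 1
  refine Finset.sum_congr rfl fun i _ => ?_
  rw [← integral_const_mul]
  congr 1
  funext ω
  rw [linFun_eq_dotProduct, linFun_eq_dotProduct, WithLp.ofLp_smul, dotProduct_smul, smul_eq_mul,
    mul_pow]

lemma lambdaMin_sq_mul_le (X : Fin n → Ω → Fin p → ℝ) (β : EuclideanSpace ℝ (Fin p)) :
    lambdaMin μ X ^ 2 * ‖β‖ ^ 2 ≤ theoNorm μ X (linFun β) ^ 2 := by
  by_cases hβ : β = 0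
  · simp [hβ, sq_nonneg]
  have hn : ‖β‖ ≠ 0 := norm_ne_zero_iff.2 hβ
  have hlow : ∀ x ∈ (fun β : EuclideanSpace ℝ (Fin p) => theoNorm μ X (linFun β) ^ 2) ''
      {β | ‖β‖ = 1}, (0 : ℝ) ≤ x := by
    rintro _ ⟨γ, _, rfl⟩
    exact sq_nonneg _
  have h1 : lambdaMin μ X ^ 2 ≤ theoNorm μ X (linFun (‖β‖⁻¹ • β)) ^ 2 := by
    rw [lambdaMin, Real.sq_sqrt (Real.sInf_nonneg hlow)]
    refine csInf_le ⟨0, hlow⟩ ⟨_, ?_, rfl⟩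
    simp [norm_smul, hn]
  rw [theoNorm_sq_smul, inv_pow] at h1
  rwa [← div_eq_inv_mul, le_div_iff₀ (by positivity)] at h1

/-- For `n = 0` the empty sum divided by zero is `0`, so every theoretical norm, and hence
`lambdaMin`, would vanish. -/
lemma natCast_pos_of_lambdaMin_pos (hp : 0 < p) (hΛ : 0 < lambdaMin μ X) : (0 : ℝ) < n := by
  rcases Nat.eq_zero_or_pos n with rfl | h
  · have h := lambdaMin_sq_mul_le (μ := μ) X (EuclideanSpace.single ⟨0, hp⟩ 1)
    rw [theoNorm_sq] at h
    simp at h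
    exact absurd h hΛ.ne'
  · exact_mod_cast h

/-- The Gram matrix. -/
noncomputable def gram (μ : Measure Ω) (X : Fin n → Ω → Fin p → ℝ) : Matrix (Fin p) (Fin p) ℝ :=
  Matrix.of fun j k => (∑ i, ∫ ω, X i ω j * X i ω k ∂μ) / n

lemma integrable_mul_of_bounded [IsProbabilityMeasure μ] (hX : ∀ i, Measurable (X i)) {K : ℝ}
    (hK : ∀ i ω j, |X i ω j| ≤ K) (i : Fin n) (j k : Fin p) :
    Integrable (fun ω => X i ω j * X i ω k) μ := by
  have hm (j : Fin p) : Measurable fun ω => X i ω j := (measurable_pi_apply j).comp (hX i)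
  refine Integrable.of_bound ((hm j).mul (hm k)).aestronglyMeasurable (K * K)
    (Filter.Eventually.of_forall fun ω => ?_)
  rw [Real.norm_eq_abs, abs_mul]
  exact mul_le_mul (hK i ω j) (hK i ω k) (abs_nonneg _) ((abs_nonneg _).trans (hK i ω j))

lemma dotProduct_gram_mulVec [IsProbabilityMeasure μ] (hX : ∀ i, Measurable (X i)) {K : ℝ}
    (hK : ∀ i ω j, |X i ω j| ≤ K) (x : Fin p → ℝ) :
    x ⬝ᵥ gram μ X *ᵥ x = (∑ i, ∫ ω, (X i ω ⬝ᵥ x) ^ 2 ∂μ) / n := by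
  have hI := integrable_mul_of_bounded (μ := μ) hX hK
  have h1 (i : Fin n) : ∫ ω, (X i ω ⬝ᵥ x) ^ 2 ∂μ =
      ∑ j, ∑ k, x j * (∫ ω, X i ω j * X i ω k ∂μ) * x k := by
    have e (ω : Ω) : (X i ω ⬝ᵥ x) ^ 2 = ∑ j, ∑ k, x j * (X i ω j * X i ω k) * x k := by
      rw [sq, dotProduct, Finset.sum_mul_sum]
      exact Finset.sum_congr rfl fun j _ => Finset.sum_congr rfl fun k _ => by ring
    simp_rw [e]
    rw [integral_finsetSum _ fun j _ => integrable_finsetSum _ fun k _ =>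
      ((hI i j k).const_mul _).mul_const _]
    refine Finset.sum_congr rfl fun j _ => ?_
    rw [integral_finsetSum _ fun k _ => ((hI i j k).const_mul _).mul_const _]
    refine Finset.sum_congr rfl fun k _ => ?_
    rw [integral_mul_const, integral_const_mul]
  simp_rw [h1]
  rw [Finset.sum_comm, Finset.sum_div]
  refine Finset.sum_congr rfl fun j _ => ?_
  rw [Finset.sum_comm, Finset.sum_div, Matrix.mulVec, dotProduct, Finset.mul_sum]
  refine Finset.sum_congr rfl fun k _ => ?_
  rw [gram, Matrix.of_apply, ← Finset.sum_mul, ← Finset.mul_sum]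
  ring

lemma theoNorm_sq_toLp [IsProbabilityMeasure μ] (hX : ∀ i, Measurable (X i)) {K : ℝ}
    (hK : ∀ i ω j, |X i ω j| ≤ K) (x : Fin p → ℝ) :
    theoNorm μ X (linFun (WithLp.toLp 2 x)) ^ 2 = x ⬝ᵥ gram μ X *ᵥ x := by
  rw [theoNorm_sq, dotProduct_gram_mulVec hX hK]
  rfl

lemma lambdaMin_sq_mul_dotProduct_le [IsProbabilityMeasure μ] (hX : ∀ i, Measurable (X i)) {K : ℝ}
    (hK : ∀ i ω j, |X i ω j| ≤ K) (x : Fin p → ℝ) :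
    lambdaMin μ X ^ 2 * (x ⬝ᵥ x) ≤ x ⬝ᵥ gram μ X *ᵥ x := by
  rw [← theoNorm_sq_toLp hX hK]
  convert lambdaMin_sq_mul_le (μ := μ) X (WithLp.toLp 2 x) using 2
  rw [← real_inner_self_eq_norm_sq, EuclideanSpace.inner_toLp_toLp]
  rfl

lemma posDef_gram [IsProbabilityMeasure μ] (hX : ∀ i, Measurable (X i)) {K : ℝ}
    (hK : ∀ i ω j, |X i ω j| ≤ K) (hΛ : 0 < lambdaMin μ X) : (gram μ X).PosDef := by
  refine Matrix.PosDef.of_dotProduct_mulVec_pos ?_ fun x hx => ?_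
  · ext j k
    simp [gram, mul_comm]
  · refine lt_of_lt_of_le ?_ (lambdaMin_sq_mul_dotProduct_le hX hK x)
    have : 0 < x ⬝ᵥ x := by
      refine lt_of_le_of_ne (Finset.sum_nonneg fun j _ => mul_self_nonneg _) fun h => hx ?_
      exact dotProduct_self_eq_zero.1 h.symm
    positivity

end EmpiricalNorm

/-! ### Choice of parameters and the deviation inequality. -/

namespace EmpiricalNorm

variable {Ω : Type*} [MeasurableSpace Ω] {μ : Measure Ω} {n p : ℕ} {X : Fin n → Ω → Fin p → ℝ}

/-- Choice of the Chernoff parameter. -/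
lemma exists_chernoff_parameter {N B q t L : ℝ} (hN : 0 < N) (hB : 0 < B) (hq : 2 ≤ q)
    (ht : 0 < t) (hL : L = Real.log q + t) :
    ∃ s : ℝ, 0 ≤ s ∧ 4 * s * B ≤ 1 ∧
      Real.exp (-s * (36 * (Real.sqrt (B * L / N) + B * L / N) * N)) *
        (2 * q * Real.exp (2 * s ^ 2 * B * N)) ^ 2 ≤ Real.exp (-t) := by
  have hlq : 0 ≤ Real.log q := Real.log_nonneg (by linarith)
  have hL0 : 0 < L := by linarith
  set a := B * L / N with ha
  have ha0 : 0 < a := by positivity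
  have haN : a * N = B * L := by rw [ha]; field_simp
  have hr := Real.sq_sqrt ha0.le
  have hr0 : 0 < Real.sqrt a := Real.sqrt_pos.2 ha0
  set r := Real.sqrt a with hrdef
  -- As `q ≥ 2`, the prefactor is at most `q ^ 4`, and `4 log q + t ≤ 5 L`.
  have h2q : (2 * q) ^ 2 ≤ Real.exp (4 * Real.log q) := by
    have : Real.exp (4 * Real.log q) = q ^ 4 := by
      rw [mul_comm, Real.exp_mul, Real.exp_log (by linarith)]
      exact_mod_cast rfl
    rw [this]
    nlinarith [mul_self_nonneg q, mul_nonneg (mul_self_nonneg q) (by nlinarith : 0 ≤ q ^ 2 - 4)]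
  have reduce (s : ℝ) (h : 4 * s ^ 2 * B * N + 5 * L ≤ s * (36 * (r + a) * N)) :
      Real.exp (-s * (36 * (r + a) * N)) * (2 * q * Real.exp (2 * s ^ 2 * B * N)) ^ 2 ≤
        Real.exp (-t) := by
    rw [mul_pow, ← Real.exp_nat_mul]
    calc _ ≤ Real.exp (-s * (36 * (r + a) * N)) * (Real.exp (4 * Real.log q) *
          Real.exp ((2 : ℕ) * (2 * s ^ 2 * B * N))) := by gcongr
      _ ≤ _ := by
          rw [← Real.exp_add, ← Real.exp_add, Real.exp_le_exp]
          push_cast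
          linarith
  by_cases hra : 4 * r ≤ 1
  · refine ⟨r / B, by positivity, ?_, reduce _ ?_⟩
    · rw [mul_div_assoc', div_mul_cancel₀ _ hB.ne']
      exact hra
    · have e1 : 4 * (r / B) ^ 2 * B * N = 4 * L := by
        rw [div_pow, hr]
        field_simp
        linarith
      have e2 : r / B * (36 * (r + a) * N) = 36 * L + 36 * r * L := by
        have : r / B * (36 * (r + a) * N) = 36 * (r ^ 2 * N) / B + 36 * r * (a * N) / B := by
          field_simp
        rw [this, hr, haN]
        field_simp
      rw [e1, e2]
      nlinarith
  · push Not at hra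
    -- The balanced choice would violate `4 s B ≤ 1`, so `s` takes its largest admissible value. The
    -- linear part of the threshold then gives `9 L`, and its square root part absorbs the quadratic
    -- cost.
    refine ⟨1 / (4 * B), by positivity, ?_, reduce _ ?_⟩
    · field_simp; exact le_rfl
    · have e2 : 1 / (4 * B) * (36 * (r + a) * N) = 9 * (r * N) / B + 9 * L := by
        have : 1 / (4 * B) * (36 * (r + a) * N) = 9 * (r * N) / B + 9 * (a * N) / B := by
          field_simp; ring
        rw [this, haN]
        field_simp
      have e1 : 4 * (1 / (4 * B)) ^ 2 * B * N = N / (4 * B) := by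
        field_simp
      rw [e1, e2]
      have : N / (4 * B) ≤ 9 * (r * N) / B := by
        rw [div_le_div_iff₀ (by positivity) hB]
        have : 1 ≤ 36 * r := by linarith
        nlinarith [mul_le_mul_of_nonneg_right this (by positivity : 0 ≤ N * B)]
      linarith

/-- The deviation inequality for rows that are bounded everywhere. -/
theorem measure_supDeviation_le_of_bounded [IsProbabilityMeasure μ] (hp : 2 ≤ p)
    (hX : ∀ i, Measurable (X i)) (hind : iIndepFun X μ) {K : ℝ} (hK0 : 0 < K)
    (hK : ∀ i ω j, |X i ω j| ≤ K) (hΛ : 0 < lambdaMin μ X) {t : ℝ} (ht : 0 < t) :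
    μ {ω | ENNReal.ofReal
          (36 * (K / lambdaMin μ X * Real.sqrt ((p * Real.log p + p * t) / n)
            + K ^ 2 / lambdaMin μ X ^ 2 * ((p * Real.log p + p * t) / n)))
        ≤ supDeviation μ X ω} ≤ ENNReal.ofReal (Real.exp (-t)) := by
  have hp' : (2 : ℝ) ≤ p := by exact_mod_cast hp
  have hp0 : (0 : ℝ) < p := by linarith
  have : Nonempty (Fin p) := ⟨⟨0, by omega⟩⟩
  have hn : (0 : ℝ) < n := natCast_pos_of_lambdaMin_pos (by omega) hΛ
  obtain ⟨W, V, hWV, hW⟩ := (posDef_gram hX hK hΛ).exists_whitening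
  set Λ := lambdaMin μ X with hΛdef
  set Y : Ω → Fin n → Fin p → ℝ := fun ω i => Wᵀ *ᵥ X i ω with hYdef
  have hYx (ω : Ω) (i : Fin n) (x : Fin p → ℝ) : Y ω i ⬝ᵥ x = X i ω ⬝ᵥ W *ᵥ x := by
    change (Wᵀ *ᵥ X i ω) ⬝ᵥ x = _
    rw [Matrix.mulVec_transpose, Matrix.dotProduct_mulVec]
  have cW : Continuous fun x : Fin p → ℝ => Wᵀ *ᵥ x := Continuous.matrix_mulVec continuous_const
    continuous_id
  have hY : Measurable Y := measurable_pi_lambda _ fun i => cW.measurable.comp (hX i)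
  have hYind : iIndepFun (fun i ω => Y ω i) μ := hind.comp _ fun i => cW.measurable
  have hiso (x : Fin p → ℝ) : ∑ i, ∫ ω, (Y ω i ⬝ᵥ x) ^ 2 ∂μ = n * (x ⬝ᵥ x) := by
    rw [← hW x, dotProduct_gram_mulVec hX hK]
    simp_rw [hYx]
    field_simp
  set B := p * K ^ 2 / Λ ^ 2 with hB
  have hB0 : 0 < B := by positivity
  have hYB (ω : Ω) (i : Fin n) : Y ω i ⬝ᵥ Y ω i ≤ B := by
    set y := Y ω i with hy
    have hy0 : 0 ≤ y ⬝ᵥ y := Finset.sum_nonneg fun j _ => mul_self_nonneg _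
    have h1 : y ⬝ᵥ y = X i ω ⬝ᵥ W *ᵥ y := hYx ω i y
    have h2 := lambdaMin_sq_mul_dotProduct_le (μ := μ) hX hK (W *ᵥ y)
    rw [hW, ← hΛdef] at h2
    -- Cauchy–Schwarz for `y ⬝ᵥ y = X i ω ⬝ᵥ W *ᵥ y`, with `|W y|² ≤ |y|² / Λ²`; one factor `y ⬝ᵥ y`
    -- then cancels.
    have h3 : (X i ω ⬝ᵥ W *ᵥ y) ^ 2 ≤ (X i ω ⬝ᵥ X i ω) * (W *ᵥ y ⬝ᵥ W *ᵥ y) := by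
      have := Finset.sum_mul_sq_le_sq_mul_sq Finset.univ (X i ω) (W *ᵥ y)
      simpa only [dotProduct, sq] using this
    have h4 : X i ω ⬝ᵥ X i ω ≤ p * K ^ 2 := by
      calc X i ω ⬝ᵥ X i ω ≤ ∑ _j : Fin p, K ^ 2 := Finset.sum_le_sum fun j _ => by
            rw [← sq]; exact sq_le_sq' (abs_le.1 (hK i ω j)).1 (abs_le.1 (hK i ω j)).2
        _ = _ := by simp
    have hw0 : 0 ≤ W *ᵥ y ⬝ᵥ W *ᵥ y := Finset.sum_nonneg fun j _ => mul_self_nonneg _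
    rw [← h1] at h3
    rw [hB, le_div_iff₀ (by positivity)]
    rcases hy0.eq_or_lt with h | h
    · rw [← h, zero_mul]; positivity
    · have h5 : (y ⬝ᵥ y) * ((y ⬝ᵥ y) * Λ ^ 2) ≤ (y ⬝ᵥ y) * (p * K ^ 2) := by
        calc (y ⬝ᵥ y) * ((y ⬝ᵥ y) * Λ ^ 2) = (y ⬝ᵥ y) ^ 2 * Λ ^ 2 := by ring
          _ ≤ (p * K ^ 2 * (W *ᵥ y ⬝ᵥ W *ᵥ y)) * Λ ^ 2 :=
              mul_le_mul_of_nonneg_right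
                (h3.trans (mul_le_mul_of_nonneg_right h4 hw0)) (by positivity)
          _ = p * K ^ 2 * (Λ ^ 2 * (W *ᵥ y ⬝ᵥ W *ᵥ y)) := by ring
          _ ≤ p * K ^ 2 * (y ⬝ᵥ y) := mul_le_mul_of_nonneg_left h2 (by positivity)
          _ = _ := by ring
      exact le_of_mul_le_mul_left h5 h
  have hYC (ω : Ω) : ‖Y ω‖ ≤ Real.sqrt B := by
    rw [pi_norm_le_iff_of_nonneg (Real.sqrt_nonneg _)]
    intro i
    rw [pi_norm_le_iff_of_nonneg (Real.sqrt_nonneg _)]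
    intro j
    refine Real.le_sqrt_of_sq_le (le_trans ?_ (hYB ω i))
    rw [Real.norm_eq_abs, sq_abs, sq]
    exact Finset.single_le_sum (f := fun j => Y ω i j * Y ω i j) (fun k _ => mul_self_nonneg _)
      (Finset.mem_univ j)
  set a := B * (Real.log p + t) / n with ha
  have hlogp : 0 ≤ Real.log p := Real.log_nonneg (by linarith)
  have ha0 : 0 < a := by positivity
  have hthr : 36 * (K / Λ * Real.sqrt ((p * Real.log p + p * t) / n)
      + K ^ 2 / Λ ^ 2 * ((p * Real.log p + p * t) / n)) = 36 * (Real.sqrt a + a) := by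
    have e1 : K ^ 2 / Λ ^ 2 * ((p * Real.log p + p * t) / n) = a := by
      rw [ha, hB]; field_simp
    have e2 : K / Λ * Real.sqrt ((p * Real.log p + p * t) / n) = Real.sqrt a := by
      rw [← e1, ← div_pow, Real.sqrt_mul (sq_nonneg _), Real.sqrt_sq (by positivity)]
    rw [e1, e2]
  have hsup (ω : Ω) : supDeviation μ X ω ≤
      ENNReal.ofReal (‖∑ i, rankOne (Y ω) i - (n : ℝ) • (1 : Matrix (Fin p) (Fin p) ℝ)‖ / n) := by
    refine iSup₂_le fun β hβ => ENNReal.ofReal_le_ofReal ?_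
    set z := V *ᵥ β.ofLp with hz
    have hWz : W *ᵥ z = β.ofLp := by
      rw [hz, Matrix.mulVec_mulVec, hWV, Matrix.one_mulVec]
    have hzz : theoNorm μ X (linFun β) ^ 2 = z ⬝ᵥ z := by
      rw [← hW z, hWz]
      exact theoNorm_sq_toLp hX hK β.ofLp
    have hz1 : z ⬝ᵥ z ≤ 1 := by
      rw [← hzz]
      exact pow_le_one₀ (Real.sqrt_nonneg _) hβ
    have hz0 : 0 ≤ z ⬝ᵥ z := Finset.sum_nonneg fun j _ => mul_self_nonneg _
    have h1 : empNorm X (linFun β) ω ^ 2 - theoNorm μ X (linFun β) ^ 2 =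
        (z ⬝ᵥ (∑ i, rankOne (Y ω) i - (n : ℝ) • (1 : Matrix (Fin p) (Fin p) ℝ)) *ᵥ z) / n := by
      rw [hzz, empNorm_sq, Matrix.sub_mulVec, dotProduct_sub, dotProduct_sum_rankOne_mulVec,
        Matrix.smul_mulVec, Matrix.one_mulVec, dotProduct_smul, smul_eq_mul, sub_div,
        mul_div_cancel_left₀ _ hn.ne']
      simp_rw [hYx, hWz]
      rfl
    rw [h1, abs_div, abs_of_pos hn]
    refine div_le_div_of_nonneg_right ((Matrix.abs_dotProduct_mulVec_le _ _).trans ?_) hn.le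
    exact mul_le_of_le_one_right (norm_nonneg _) hz1
  obtain ⟨s, hs0, hsB, hs⟩ := exists_chernoff_parameter hn hB0 hp' ht rfl
  have hmain := measure_le_norm_sum_rankOne_sub_le hY hYind hYC hiso hn.le hB0.le hYB hs0 hsB
    (36 * (Real.sqrt a + a) * n)
  rw [Fintype.card_fin] at hmain
  refine (measure_mono fun ω hω => ?_).trans (hmain.trans (ENNReal.ofReal_le_ofReal hs))
  simp only [Set.mem_ofPred_eq] at hω ⊢
  rw [hthr] at hω
  have h2 := hω.trans (hsup ω)
  rw [ENNReal.ofReal_le_ofReal_iff (by positivity), le_div_iff₀ hn] at h2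
  exact h2

lemma theoNorm_congr_ae {X' : Fin n → Ω → Fin p → ℝ} (h : ∀ i, X i =ᵐ[μ] X' i) :
    theoNorm μ X = theoNorm μ X' := by
  funext f
  unfold theoNorm theoMeasure
  congr 2
  refine Finset.sum_congr rfl fun i _ => integral_congr_ae ?_
  filter_upwards [h i] with ω hω
  rw [hω]

end EmpiricalNorm

theorem theoreml3 :
    ∃ c₁ : ℝ, 0 < c₁ ∧
      ∀ (Ω : Type*) [MeasurableSpace Ω] (μ : Measure Ω) [IsProbabilityMeasure μ]
        (n p : ℕ) (_hp : 2 ≤ p) (X : Fin n → Ω → Fin p → ℝ)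
        (_hmeas : ∀ i, Measurable (X i)) (_hindep : iIndepFun X μ)
        (K_X : ℝ) (_hbdd : ∀ i j, ∀ᵐ ω ∂μ, |X i ω j| ≤ K_X)
        (_hΛ : 0 < EmpiricalNorm.lambdaMin μ X)
        (t : ℝ) (_ht : 0 < t),
        μ {ω | ENNReal.ofReal
              (c₁ * (K_X / EmpiricalNorm.lambdaMin μ X *
                    Real.sqrt ((p * Real.log p + p * t) / n)
                + K_X ^ 2 / EmpiricalNorm.lambdaMin μ X ^ 2 *
                    ((p * Real.log p + p * t) / n)))
            ≤ EmpiricalNorm.supDeviation μ X ω}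
          ≤ ENNReal.ofReal (Real.exp (-t)) := by
  refine ⟨36, by norm_num, ?_⟩
  intro Ω _ μ _ n p hp X hX hind K hK hΛ t ht
  have hn : (0 : ℝ) < n := EmpiricalNorm.natCast_pos_of_lambdaMin_pos (by omega) hΛ
  have hn' : 0 < n := by exact_mod_cast hn
  have hKall : ∀ᵐ ω ∂μ, ∀ i j, |X i ω j| ≤ K :=
    ae_all_iff.2 fun i => ae_all_iff.2 fun j => hK i j
  have hK0 : 0 ≤ K := by
    obtain ⟨ω, hω⟩ := (hK ⟨0, hn'⟩ ⟨0, by omega⟩).exists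
    exact (abs_nonneg _).trans hω
  -- Clamping entries to `[-K, K]` makes the almost sure bound hold everywhere. It preserves
  -- measurability and independence and changes the rows only on a null set.
  set c : (Fin p → ℝ) → Fin p → ℝ := fun x j => max (-K) (min K (x j)) with hc
  have hcm : Measurable c := by fun_prop
  set X' : Fin n → Ω → Fin p → ℝ := fun i ω => c (X i ω) with hX'
  have hXX : ∀ᵐ ω ∂μ, ∀ i, X i ω = X' i ω := by
    filter_upwards [hKall] with ω hω i
    funext j
    have := abs_le.1 (hω i j)
    simp only [hX', hc]
    rw [min_eq_right this.2, max_eq_right this.1]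
  have hth : EmpiricalNorm.theoNorm μ X = EmpiricalNorm.theoNorm μ X' :=
    EmpiricalNorm.theoNorm_congr_ae fun i => hXX.mono fun ω hω => hω i
  have hlam : EmpiricalNorm.lambdaMin μ X = EmpiricalNorm.lambdaMin μ X' := by
    unfold EmpiricalNorm.lambdaMin
    rw [hth]
  have hb' : ∀ i ω j, |X' i ω j| ≤ K := fun i ω j =>
    abs_le.2 ⟨le_max_left _ _, max_le (by linarith) (min_le_left _ _)⟩
  -- If `K = 0`, the clamped rows vanish identically, forcing `lambdaMin` to be zero.
  have hKpos : 0 < K := by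
    refine hK0.lt_of_ne' fun h0 => hΛ.ne' ?_
    have h := EmpiricalNorm.lambdaMin_sq_mul_le (μ := μ) X'
      (EuclideanSpace.single ⟨0, by omega⟩ 1)
    have hz (i : Fin n) (ω : Ω) : X' i ω = 0 := by
      funext j
      have := hb' i ω j
      rw [h0] at this
      exact abs_nonpos_iff.1 this
    rw [EmpiricalNorm.theoNorm_sq] at h
    simp only [hz, EmpiricalNorm.linFun_eq_dotProduct, zero_dotProduct] at h
    rw [hlam]
    simpa using h
  have key := EmpiricalNorm.measure_supDeviation_le_of_bounded hp (fun i => hcm.comp (hX i))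
    (hind.comp _ fun _ => hcm) hKpos hb' (hlam ▸ hΛ) ht
  rw [hlam]
  refine (measure_mono_ae ?_).trans key
  filter_upwards [hXX] with ω hω h
  have hs : EmpiricalNorm.supDeviation μ X ω = EmpiricalNorm.supDeviation μ X' ω := by
    unfold EmpiricalNorm.supDeviation EmpiricalNorm.empNorm EmpiricalNorm.empMeasure
    simp only [hω, hth]
  have h' : _ ≤ EmpiricalNorm.supDeviation μ X ω := h
  rw [hs] at h'
  exact h'
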